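/- Let $\Gamma$ be a (discrete) amenable group, i.e. a group admitting an $\mathbb{R}$-linear map $m\colon \ell^\infty(\Gamma,\mathbb{R})\to\mathbb{R}$ that is normalised ($m(1)=1$), positive, and invariant under the action of $\Gamma$ on $\ell^\infty(\Gamma,\mathbb{R})$ induced by right translation of $\Gamma$ on itself. Let $C_*(\Gamma)$ be the simplicial $\mathbb{R}\Gamma$-resolution of $\mathbb{R}$: $C_n(\Gamma)$ is the real vector space with basis $\Gamma^{n+1}$, with the diagonal $\Gamma$-action and the boundary operator $\partial(\gamma_0,\dots,\gamma_n)=\sum_{i=0}^n(-1)^i(\gamma_0,\dots,\widehat{\gamma_i},\dots,\gamma_n)$. Equip $C_*(\Gamma;\mathbb{R}):=\mathbb{R}\otimes_{\mathbb{R}\Gamma}C_*(\Gamma)$ with the $\ell^1$-norm with respect to the basis given by all $(n+1)$-tuples whose $0$-th vertex is $1$, and let $C_*^{\ell^1}(\Gamma;\mathbb{R})$ be the chain complex obtained by completing each $C_n(\Gamma;\mathbb{R})$ with respect to this norm and extending the boundary operators continuously. Let $H_n^{\ell^1}(\Gamma;\mathbb{R})$ be the $n$-th homology (kernel modulo image,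 without taking closures) of $C_*^{\ell^1}(\Gamma;\mathbb{R})$. Then, for every $n\in\mathbb{N}_{>0}$, $$H_n^{\ell^1}(\Gamma;\mathbb{R})\cong 0.$$ -/

import Mathlib

open CategoryTheory

noncomputable section

universe u

/-! ### Amenable groups -/

/-- Bounded real-valued functions on the discrete group `Γ`, with the supremum norm. -/
abbrev EllInfty (Γ : Type u) : Type u := lp (fun _ : Γ => ℝ) ⊤

/-- The action of `g` on bounded functions induced by right translation of `Γ` on itself:
`(g • f) x = f (x * g)`. -/
def EllInfty.rightTranslate {Γ : Type u} [Group Γ] (g : Γ) (f : EllInfty Γ) : EllInfty Γ :=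
  ⟨fun x => f (x * g), by
    have hf := memℓp_infty_iff.1 (lp.memℓp f)
    refine memℓp_infty_iff.2 (hf.mono ?_)
    rintro _ ⟨x, rfl⟩
    exact ⟨x * g, rfl⟩⟩

/-- A group is amenable if it admits an invariant mean, i.e. a linear functional on the bounded
functions which is normalised, positive, and invariant. -/
def IsAmenableGroup (Γ : Type u) [Group Γ] : Prop :=
  ∃ m : EllInfty Γ →ₗ[ℝ] ℝ,
    m 1 = 1 ∧
    (∀ f : EllInfty Γ, (∀ x, 0 ≤ f x) → 0 ≤ m f) ∧
    ∀ (g : Γ) (f : EllInfty Γ), m (f.rightTranslate g) = m f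

namespace EllOneHomology

/-! ### The simplicial resolution -/

/-- Degree `n` of the simplicial resolution: the free real vector space on `(n+1)`-tuples. -/
abbrev SimplicialChain (Γ : Type u) (n : ℕ) : Type u := (Fin (n + 1) → Γ) →₀ ℝ

/-- The boundary `∂ (γ₀, …, γₙ₊₁) = ∑ᵢ (-1)ⁱ (γ₀, …, γᵢ omitted, …, γₙ₊₁)`. -/
def simplicialBoundary (Γ : Type u) (n : ℕ) :
    SimplicialChain Γ (n + 1) →ₗ[ℝ] SimplicialChain Γ n :=
  ∑ i : Fin (n + 2), (-1 : ℝ) ^ (i : ℕ) •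
    Finsupp.lmapDomain ℝ ℝ (fun x : Fin (n + 2) → Γ => i.removeNth x)

lemma simplicialBoundary_single (Γ : Type u) (n : ℕ) (x : Fin (n + 2) → Γ) (a : ℝ) :
    simplicialBoundary Γ n (Finsupp.single x a) =
      ∑ i : Fin (n + 2), (-1 : ℝ) ^ (i : ℕ) • Finsupp.single (i.removeNth x) a := by
  simp [simplicialBoundary, LinearMap.sum_apply, Finsupp.mapDomain_single]

theorem simplicialBoundary_comp (Γ : Type u) (n : ℕ) :
    simplicialBoundary Γ n ∘ₗ simplicialBoundary Γ (n + 1) = 0 := by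
  ext x : 2
  simp only [LinearMap.comp_apply, Finsupp.lsingle_apply, simplicialBoundary_single, map_sum,
    map_smul, Finset.smul_sum, smul_smul, LinearMap.zero_apply]
  rw [← Finset.sum_product']
  refine Finset.sum_involution
    (fun ij _ => (ij.1.succAbove ij.2, ij.2.predAbove ij.1)) ?_ ?_ ?_ ?_
  · rintro ⟨i, j⟩ -
    rw [Fin.removeNth_removeNth_eq_swap x j i, ← add_smul, ← pow_add, ← pow_add,
      Fin.neg_one_pow_succAbove_add_predAbove]
    simp
  · rintro ⟨i, j⟩ - - h
    exact Fin.succAbove_ne i j (congrArg Prod.fst h)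
  · rintro ⟨i, j⟩ -
    simp
  · rintro ⟨i, j⟩ -
    exact Prod.ext (Fin.succAbove_succAbove_predAbove i j) (Fin.predAbove_predAbove_succAbove i j)

variable (Γ : Type u) [Group Γ]

/-- The diagonal left action of `Γ` on the simplicial resolution,
`g • (γ₀, …, γₙ) = (g γ₀, …, g γₙ)`. -/
def diagonalRep (n : ℕ) : Representation ℝ Γ (SimplicialChain Γ n) where
  toFun g := Finsupp.lmapDomain ℝ ℝ (fun x => g • x)
  map_one' := by ext x; simp
  map_mul' g h := by ext x; simp [mul_smul]

@[simp]
lemma diagonalRep_single (n : ℕ) (g : Γ) (x : Fin (n + 1) → Γ) (a : ℝ) :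
    diagonalRep Γ n g (Finsupp.single x a) = Finsupp.single (g • x) a := by
  simp [diagonalRep]

lemma simplicialBoundary_equivariant (n : ℕ) (g : Γ) :
    simplicialBoundary Γ n ∘ₗ diagonalRep Γ (n + 1) g =
      diagonalRep Γ n g ∘ₗ simplicialBoundary Γ n := by
  ext x : 2
  simp only [LinearMap.comp_apply, Finsupp.lsingle_apply, diagonalRep_single,
    simplicialBoundary_single, map_sum, map_smul]
  rfl

/-! ### The chain complex of the group, with its `ℓ¹`-norm -/

/-- `C_n(Γ; ℝ) = ℝ ⊗_{ℝΓ} C_n(Γ)`: the coinvariants of the simplicial resolution. -/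
def GroupChain (n : ℕ) : Type u := (diagonalRep Γ n).Coinvariants

namespace GroupChain

instance (n : ℕ) : AddCommGroup (GroupChain Γ n) :=
  inferInstanceAs (AddCommGroup (diagonalRep Γ n).Coinvariants)

instance (n : ℕ) : Module ℝ (GroupChain Γ n) :=
  inferInstanceAs (Module ℝ (diagonalRep Γ n).Coinvariants)

/-- The canonical projection `C_n(Γ) → C_n(Γ; ℝ)`. -/
def proj (n : ℕ) : SimplicialChain Γ n →ₗ[ℝ] GroupChain Γ n :=
  Representation.Coinvariants.mk (diagonalRep Γ n)

variable {Γ} in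
lemma proj_surjective (n : ℕ) : Function.Surjective (proj Γ n) :=
  Representation.Coinvariants.mk_surjective _

variable {Γ} in
@[simp]
lemma proj_smul (n : ℕ) (g : Γ) (x : Fin (n + 1) → Γ) (a : ℝ) :
    proj Γ n (Finsupp.single (g • x) a) = proj Γ n (Finsupp.single x a) := by
  rw [← diagonalRep_single]
  exact Representation.Coinvariants.mk_self_apply _ g _

/-- The `(n+1)`-tuples in `Γ` whose `0`-th vertex is `1`. -/
abbrev NormalTuple (n : ℕ) : Type u := {x : Fin (n + 1) → Γ // x 0 = 1}

/-- The representative with `0`-th vertex `1` of the `Γ`-orbit of a tuple. -/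
def normalize (n : ℕ) (x : Fin (n + 1) → Γ) : NormalTuple Γ n :=
  ⟨(x 0)⁻¹ • x, by simp⟩

/-- The linear isomorphism between `C_n(Γ; ℝ)` and the free vector space on the tuples with
`0`-th vertex `1`; its inverse sends such a tuple to its class. -/
def coords (n : ℕ) : GroupChain Γ n ≃ₗ[ℝ] (NormalTuple Γ n →₀ ℝ) :=
  LinearEquiv.ofLinearMap
    (Representation.Coinvariants.lift (diagonalRep Γ n)
      (Finsupp.lmapDomain ℝ ℝ (normalize Γ n)) (fun g => by
        ext x : 2
        simp only [LinearMap.comp_apply, Finsupp.lsingle_apply, diagonalRep_single,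
          Finsupp.lmapDomain_apply, Finsupp.mapDomain_single]
        congr 1
        ext i
        simp [normalize, mul_assoc]))
    (proj Γ n ∘ₗ Finsupp.lmapDomain ℝ ℝ Subtype.val)
    (by
      ext x : 2
      change Finsupp.lmapDomain ℝ ℝ (normalize Γ n)
        (Finsupp.lmapDomain ℝ ℝ Subtype.val (Finsupp.single x 1)) = Finsupp.single x 1
      simp only [Finsupp.lmapDomain_apply, Finsupp.mapDomain_single]
      congr 1
      ext i
      simp [normalize, x.2])
    (by
      apply Representation.Coinvariants.hom_ext
      ext x : 2
      change proj Γ n (Finsupp.lmapDomain ℝ ℝ Subtype.val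
        (Finsupp.lmapDomain ℝ ℝ (normalize Γ n) (Finsupp.single x 1))) =
          proj Γ n (Finsupp.single x 1)
      simp only [Finsupp.lmapDomain_apply, Finsupp.mapDomain_single]
      exact proj_smul n (x 0)⁻¹ x 1)

variable {Γ} in
@[simp]
lemma coords_symm_single (n : ℕ) (x : NormalTuple Γ n) (a : ℝ) :
    (coords Γ n).symm (Finsupp.single x a) = proj Γ n (Finsupp.single x.1 a) := by
  change proj Γ n (Finsupp.lmapDomain ℝ ℝ Subtype.val (Finsupp.single x a)) = _
  simp

variable {Γ} in
@[simp]
lemma coords_proj_single (n : ℕ) (x : Fin (n + 1) → Γ) (a : ℝ) :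
    coords Γ n (proj Γ n (Finsupp.single x a)) = Finsupp.single (normalize Γ n x) a := by
  change Finsupp.lmapDomain ℝ ℝ (normalize Γ n) (Finsupp.single x a) = _
  simp

/-- The `ℓ¹`-norm with respect to the basis of all tuples with `0`-th vertex `1`: the sum of the
absolute values of the coordinates. -/
instance (n : ℕ) : Norm (GroupChain Γ n) where
  norm c := (coords Γ n c).sum fun _ a => |a|

variable {Γ} in
lemma norm_def {n : ℕ} (c : GroupChain Γ n) : ‖c‖ = (coords Γ n c).sum fun _ a => |a| := rfl

lemma normCore (n : ℕ) : NormedSpace.Core ℝ (GroupChain Γ n) where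
  norm_nonneg c := Finset.sum_nonneg fun _ _ => abs_nonneg _
  norm_smul r c := by
    rw [norm_def, norm_def, map_smul, Finsupp.sum_smul_index' (by simp), Finsupp.mul_sum]
    simp [abs_mul]
  norm_triangle c d := by
    classical
    rw [norm_def, norm_def, norm_def, map_add]
    have h : ∀ f : NormalTuple Γ n →₀ ℝ,
        f.support ⊆ (coords Γ n c).support ∪ (coords Γ n d).support →
        (f.sum fun _ a => |a|) =
          ∑ x ∈ (coords Γ n c).support ∪ (coords Γ n d).support, |f x| := fun f hf =>
      Finsupp.sum_of_support_subset f hf _ (by simp)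
    rw [h _ Finsupp.support_add, h _ Finset.subset_union_left, h _ Finset.subset_union_right,
      ← Finset.sum_add_distrib]
    exact Finset.sum_le_sum fun x _ => abs_add_le _ _
  norm_eq_zero_iff c := by
    rw [norm_def, Finsupp.sum, Finset.sum_eq_zero_iff_of_nonneg (fun _ _ => abs_nonneg _)]
    constructor
    · intro h
      rw [← (coords Γ n).map_eq_zero_iff]
      ext x
      by_contra hx
      exact hx (abs_eq_zero.1 (h x (Finsupp.mem_support_iff.2 hx)))
    · rintro rfl
      simp

instance (n : ℕ) : NormedAddCommGroup (GroupChain Γ n) :=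
  NormedAddCommGroup.ofCore (normCore Γ n)

instance (n : ℕ) : NormedSpace ℝ (GroupChain Γ n) :=
  NormedSpace.ofCore (normCore Γ n)

/-- The boundary operator `C_{n+1}(Γ; ℝ) → C_n(Γ; ℝ)` induced by that of the resolution. -/
def boundary (n : ℕ) : GroupChain Γ (n + 1) →ₗ[ℝ] GroupChain Γ n :=
  Representation.Coinvariants.lift (diagonalRep Γ (n + 1)) (proj Γ n ∘ₗ simplicialBoundary Γ n)
    (fun g => by
      rw [LinearMap.comp_assoc, simplicialBoundary_equivariant]
      refine LinearMap.ext fun x => ?_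
      exact Representation.Coinvariants.mk_self_apply _ g _)

variable {Γ} in
@[simp]
lemma boundary_proj (n : ℕ) (c : SimplicialChain Γ (n + 1)) :
    boundary Γ n (proj Γ (n + 1) c) = proj Γ n (simplicialBoundary Γ n c) := rfl

lemma boundary_comp (n : ℕ) : boundary Γ n ∘ₗ boundary Γ (n + 1) = 0 := by
  ext c
  obtain ⟨c, rfl⟩ := proj_surjective _ c
  have h := LinearMap.congr_fun (simplicialBoundary_comp Γ n) c
  simp only [LinearMap.comp_apply, LinearMap.zero_apply] at h
  simp [h]

variable {Γ} in
lemma norm_proj_single (n : ℕ) (x : Fin (n + 1) → Γ) (a : ℝ) :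
    ‖proj Γ n (Finsupp.single x a)‖ = |a| := by
  simp [norm_def]

lemma norm_boundary_le (n : ℕ) (c : GroupChain Γ (n + 1)) :
    ‖boundary Γ n c‖ ≤ (n + 2 : ℝ) * ‖c‖ := by
  have hc : c = ∑ x ∈ (coords Γ (n + 1) c).support,
      proj Γ (n + 1) (Finsupp.single x.1 (coords Γ (n + 1) c x)) := by
    conv_lhs => rw [← (coords Γ (n + 1)).symm_apply_apply c,
      ← Finsupp.sum_single (coords Γ (n + 1) c), Finsupp.sum, map_sum]
    simp
  have hs : ∀ (x : Fin (n + 2) → Γ) (a : ℝ),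
      ‖boundary Γ n (proj Γ (n + 1) (Finsupp.single x a))‖ ≤ (n + 2 : ℝ) * |a| := by
    intro x a
    rw [boundary_proj, simplicialBoundary_single, map_sum]
    refine (norm_sum_le _ _).trans (le_of_eq ?_)
    simp only [map_smul, norm_smul, norm_proj_single]
    simp
  conv_lhs => rw [hc, map_sum]
  refine (norm_sum_le _ _).trans ?_
  rw [norm_def, Finsupp.sum, Finset.mul_sum]
  exact Finset.sum_le_sum fun x _ => hs _ _

/-- The boundary operator as a bounded operator for the `ℓ¹`-norms. -/
def boundaryL (n : ℕ) : GroupChain Γ (n + 1) →L[ℝ] GroupChain Γ n :=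
  (boundary Γ n).mkContinuous (n + 2) (norm_boundary_le Γ n)

end GroupChain

/-! ### `ℓ¹`-homology -/

/-- The `ℓ¹`-chains: the completion of `C_n(Γ; ℝ)` with respect to the `ℓ¹`-norm. -/
abbrev EllOneChain (n : ℕ) : Type u := UniformSpace.Completion (GroupChain Γ n)

/-- The continuous extension of the boundary operator to the completions. -/
def ellOneBoundary (n : ℕ) : EllOneChain Γ (n + 1) →L[ℝ] EllOneChain Γ n :=
  (GroupChain.boundaryL Γ n).completion

lemma ellOneBoundary_coe (n : ℕ) (c : GroupChain Γ (n + 1)) :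
    ellOneBoundary Γ n (c : EllOneChain Γ (n + 1)) =
      ((GroupChain.boundary Γ n c : GroupChain Γ n) : EllOneChain Γ n) :=
  ContinuousLinearMap.completion_apply_coe (GroupChain.boundaryL Γ n) c

lemma ellOneBoundary_comp (n : ℕ) (c : EllOneChain Γ (n + 2)) :
    ellOneBoundary Γ n (ellOneBoundary Γ (n + 1) c) = 0 := by
  induction c using UniformSpace.Completion.induction_on with
  | hp => exact isClosed_eq (by fun_prop) continuous_const
  | ih c =>
    rw [ellOneBoundary_coe, ellOneBoundary_coe, ← LinearMap.comp_apply, GroupChain.boundary_comp]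
    simp

/-- The `ℓ¹`-chain complex of `Γ`. -/
def ellOneComplex : ChainComplex (ModuleCat.{u} ℝ) ℕ :=
  ChainComplex.of (fun n => ModuleCat.of ℝ (EllOneChain Γ n))
    (fun n => ModuleCat.ofHom (ellOneBoundary Γ n).toLinearMap)
    (fun n => by
      ext c
      exact ellOneBoundary_comp Γ n c)

/-- `ℓ¹`-homology `H_n^{ℓ¹}(Γ; ℝ)`: the (unreduced) homology of the `ℓ¹`-chain complex. -/
def ellOneHomology (n : ℕ) : ModuleCat.{u} ℝ := (ellOneComplex Γ).homology n

end EllOneHomology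

end

/-!
The proof is a quantitative form of averaging the cone construction over the group.

Coning with apex `h` is a contracting homotopy of the simplicial resolution in positive degrees, but
it is not equivariant. Evaluating it on the representatives with `0`-th vertex `1` of the orbits
gives, for each `h`, an operator on `C_*(Γ; ℝ)` of norm at most `1`, which is a contracting homotopy
up to a defect: the cone over the difference of two lifts of the same element of `C_*(Γ; ℝ)`.
For a bounded functional `φ`, the `φ`-values of cones over a fixed chain, as a bounded function of
the inverse of the apex, have a mean that depends only on the class of the chain in `C_*(Γ; ℝ)`
(`mean_coneEval_eq_zero`), so the defects are invisible to the mean. By Hahn–Banach, `0` is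
therefore in the closed convex hull of the defects over all apexes
(`zero_mem_closure_convexHull_defect`). Hence a suitable finite convex combination of the cone
operators shows that every chain `z` of positive degree lies within `‖∂z‖ + ε` of the boundary of a
chain of norm at most `‖z‖` (`exists_norm_sub_boundary_le`).

In the completion it follows that every cycle is approximated, with relative error `1/2`, by the
boundary of a chain of comparable norm (`exists_norm_sub_ellOneBoundary_le`). As the remaining error
is again a cycle, the approximation can be iterated, and the chains obtained add up to a chain that
bounds the given cycle. No closed-range or duality theorem for `ℓ¹`-homology is needed.
-/

noncomputable section

universe u

namespace EllOneHomology

/-! ### Cones in the simplicial resolution -/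

/-- The cone with apex `a`: the linear map `(γ₀, …, γₙ) ↦ (a, γ₀, …, γₙ)`. -/
def cone {Γ : Type u} (a : Γ) (n : ℕ) : SimplicialChain Γ n →ₗ[ℝ] SimplicialChain Γ (n + 1) :=
  Finsupp.lmapDomain ℝ ℝ (fun x => Fin.cons a x)

@[simp]
lemma cone_single {Γ : Type u} (a : Γ) (n : ℕ) (x : Fin (n + 1) → Γ) (r : ℝ) :
    cone a n (Finsupp.single x r) = Finsupp.single (Fin.cons a x) r := by
  simp [cone]

lemma removeNth_succ_cons {α : Type*} {n : ℕ} (a : α) (x : Fin (n + 2) → α) (i : Fin (n + 2)) :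
    i.succ.removeNth (Fin.cons a x : Fin (n + 3) → α) =
      (Fin.cons a (i.removeNth x) : Fin (n + 2) → α) := by
  ext j
  refine Fin.cases ?_ (fun j => ?_) j <;> simp [Fin.removeNth]

lemma simplicialBoundary_cone {Γ : Type u} (a : Γ) (n : ℕ) (c : SimplicialChain Γ (n + 1)) :
    simplicialBoundary Γ (n + 1) (cone a (n + 1) c) + cone a n (simplicialBoundary Γ n c) = c := by
  suffices h : simplicialBoundary Γ (n + 1) ∘ₗ cone a (n + 1) + cone a n ∘ₗ simplicialBoundary Γ n
      = LinearMap.id from LinearMap.congr_fun h c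
  ext x : 2
  simp only [LinearMap.add_apply, LinearMap.comp_apply, Finsupp.lsingle_apply, cone_single,
    simplicialBoundary_single, map_sum, map_smul, LinearMap.id_apply]
  rw [Fin.sum_univ_succ]
  simp [removeNth_succ_cons, pow_succ]

namespace GroupChain

variable {Γ : Type u} [Group Γ]

/-- The linear section of the projection `C_n(Γ) → C_n(Γ; ℝ)` that picks in each orbit of tuples
the one with `0`-th vertex `1`. -/
def normalLift (n : ℕ) : GroupChain Γ n →ₗ[ℝ] SimplicialChain Γ n :=
  Finsupp.lmapDomain ℝ ℝ Subtype.val ∘ₗ (coords Γ n).toLinearMap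

@[simp]
lemma proj_normalLift (n : ℕ) (z : GroupChain Γ n) : proj Γ n (normalLift n z) = z :=
  (coords Γ n).symm_apply_apply z

/-- The cone operator on `C_n(Γ; ℝ)` with apex `g⁻¹` relative to the representatives with `0`-th
vertex `1`. The inverse turns the left action of `Γ` on apexes into right translation of `g`. -/
def normalCone (g : Γ) (n : ℕ) : GroupChain Γ n →ₗ[ℝ] GroupChain Γ (n + 1) :=
  proj Γ (n + 1) ∘ₗ cone g⁻¹ n ∘ₗ normalLift n

lemma norm_normalCone_le (g : Γ) (n : ℕ) (z : GroupChain Γ n) : ‖normalCone g n z‖ ≤ ‖z‖ := by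
  have hz : normalLift n z =
      ∑ x ∈ (coords Γ n z).support, Finsupp.single x.1 (coords Γ n z x) := by
    simp only [normalLift, LinearMap.comp_apply, LinearEquiv.coe_coe, Finsupp.lmapDomain_apply,
      Finsupp.mapDomain, Finsupp.sum]
  rw [normalCone, LinearMap.comp_apply, LinearMap.comp_apply, hz, map_sum, map_sum]
  refine (norm_sum_le _ _).trans (le_of_eq ?_)
  simp only [cone_single, norm_proj_single]
  rfl

/-- The failure of the cone operators to form a contracting homotopy is the cone over the
difference between two lifts of `∂z`. -/
lemma sub_boundary_normalCone (g : Γ) (n : ℕ) (z : GroupChain Γ (n + 1)) :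
    z - boundary Γ (n + 1) (normalCone g (n + 1) z) - normalCone g n (boundary Γ n z) =
      proj Γ (n + 1) (cone g⁻¹ n
        (simplicialBoundary Γ n (normalLift (n + 1) z) - normalLift n (boundary Γ n z))) := by
  have h := congrArg (proj Γ (n + 1)) (simplicialBoundary_cone g⁻¹ n (normalLift (n + 1) z))
  rw [map_add, proj_normalLift] at h
  simp only [normalCone, LinearMap.comp_apply, boundary_proj, map_sub]
  nth_rewrite 1 [← h]
  abel

/-! ### Averaging over the group -/

/-- The linear map sending `(γ₀, …, γₙ)` to the bounded function `g ↦ φ [g⁻¹, γ₀, …, γₙ]`, the values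
of `φ` on its cones with apex `g⁻¹`. -/
def coneEval {n : ℕ} (φ : GroupChain Γ (n + 1) →L[ℝ] ℝ) : SimplicialChain Γ n →ₗ[ℝ] EllInfty Γ :=
  Finsupp.linearCombination ℝ fun x : Fin (n + 1) → Γ =>
    (⟨fun g => φ (proj Γ (n + 1) (Finsupp.single (Fin.cons g⁻¹ x) 1)), by
      refine memℓp_infty_iff.2 ⟨‖φ‖, ?_⟩
      rintro _ ⟨g, rfl⟩
      simpa [norm_proj_single] using
        φ.le_opNorm (proj Γ (n + 1) (Finsupp.single (Fin.cons g⁻¹ x) 1))⟩ : EllInfty Γ)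

lemma coneEval_apply {n : ℕ} (φ : GroupChain Γ (n + 1) →L[ℝ] ℝ) (c : SimplicialChain Γ n) (g : Γ) :
    coneEval φ c g = φ (proj Γ (n + 1) (cone g⁻¹ n c)) := by
  induction c using Finsupp.induction_linear with
  | zero => simp
  | add c d hc hd => simp only [map_add, lp.coeFn_add, Pi.add_apply, hc, hd]
  | single x a =>
    have hx : Finsupp.single (Fin.cons g⁻¹ x : Fin (n + 2) → Γ) a =
        a • Finsupp.single (Fin.cons g⁻¹ x) 1 := by simp
    rw [cone_single, hx, map_smul, map_smul]
    simp [coneEval]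

/-- Moving a chain by `γ` amounts to translating the apex of the cone. -/
lemma coneEval_diagonalRep {n : ℕ} (φ : GroupChain Γ (n + 1) →L[ℝ] ℝ) (γ : Γ)
    (c : SimplicialChain Γ n) :
    coneEval φ (diagonalRep Γ n γ c) = (coneEval φ c).rightTranslate γ := by
  ext g
  change coneEval φ (diagonalRep Γ n γ c) g = coneEval φ c (g * γ)
  rw [coneEval_apply, coneEval_apply]
  congr 1
  induction c using Finsupp.induction_linear with
  | zero => simp
  | add c d hc hd => simp only [map_add, hc, hd]
  | single x a =>
    rw [diagonalRep_single, cone_single, cone_single, ← proj_smul _ γ (Fin.cons (g * γ)⁻¹ x)]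
    congr 2
    ext i
    refine Fin.cases ?_ (fun i => ?_) i <;> simp

/-- The mean of the values of cones over a chain depends only on the class of the chain in
`C_n(Γ; ℝ)`. -/
lemma mean_coneEval_eq_zero {m : EllInfty Γ →ₗ[ℝ] ℝ}
    (hm : ∀ (g : Γ) (f : EllInfty Γ), m (f.rightTranslate g) = m f)
    {n : ℕ} (φ : GroupChain Γ (n + 1) →L[ℝ] ℝ) {c : SimplicialChain Γ n} (hc : proj Γ n c = 0) :
    m (coneEval φ c) = 0 := by
  let Λ : GroupChain Γ n →ₗ[ℝ] ℝ :=
    Representation.Coinvariants.lift (diagonalRep Γ n) (m ∘ₗ coneEval φ) fun γ =>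
      LinearMap.ext fun c => by
        simp only [LinearMap.comp_apply, coneEval_diagonalRep, hm]
  change Λ (proj Γ n c) = 0
  rw [hc, map_zero]

/-- A functional separating `0` from the defects would give a bounded function with a positive lower
bound and mean zero. -/
lemma zero_mem_closure_convexHull_defect (hΓ : IsAmenableGroup Γ) (n : ℕ)
    (z : GroupChain Γ (n + 1)) :
    (0 : GroupChain Γ (n + 1)) ∈ closure (convexHull ℝ (Set.range fun g : Γ =>
      z - boundary Γ (n + 1) (normalCone g (n + 1) z) - normalCone g n (boundary Γ n z))) := by
  by_contra h
  obtain ⟨φ, u, hu, hφ⟩ :=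
    geometric_hahn_banach_point_closed (convex_convexHull ℝ _).closure isClosed_closure h
  obtain ⟨m, m_one, m_nonneg, m_inv⟩ := hΓ
  rw [map_zero] at hu
  set c := simplicialBoundary Γ n (normalLift (n + 1) z) - normalLift n (boundary Γ n z) with hc
  have hm : m (coneEval φ c) = 0 := mean_coneEval_eq_zero m_inv φ (by
    rw [hc, map_sub, proj_normalLift, ← boundary_proj, proj_normalLift, sub_self])
  have hpos : 0 ≤ m (coneEval φ c - u • 1) := m_nonneg _ fun g => by
    have := hφ _ (subset_closure (subset_convexHull ℝ _ (Set.mem_range_self g)))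
    beta_reduce at this
    rw [sub_boundary_normalCone, ← hc, ← coneEval_apply] at this
    change 0 ≤ coneEval φ c g - u * 1
    linarith
  rw [map_sub, map_smul, hm, m_one, smul_eq_mul] at hpos
  linarith

lemma exists_norm_sub_boundary_le (hΓ : IsAmenableGroup Γ) (n : ℕ) (z : GroupChain Γ (n + 1))
    {ε : ℝ} (hε : 0 < ε) :
    ∃ b : GroupChain Γ (n + 2), ‖b‖ ≤ ‖z‖ ∧ ‖z - boundary Γ (n + 1) b‖ ≤ ‖boundary Γ n z‖ + ε := by
  -- The convex combinations of the defects are tracked together with the matching combinations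
  -- of the cones over `z` and over `∂z`.
  let T := convexHull ℝ (Set.range fun g : Γ =>
    (normalCone g (n + 1) z, normalCone g n (boundary Γ n z)))
  let L : GroupChain Γ (n + 2) × GroupChain Γ (n + 1) →ₗ[ℝ] GroupChain Γ (n + 1) :=
    (boundary Γ (n + 1)).coprod LinearMap.id
  have hT : T ⊆ Metric.closedBall 0 ‖z‖ ×ˢ Metric.closedBall 0 ‖boundary Γ n z‖ := by
    refine convexHull_min ?_ ((convex_closedBall _ _).prod (convex_closedBall _ _))
    rintro _ ⟨g, rfl⟩
    exact ⟨by simpa using norm_normalCone_le g _ z, by simpa using norm_normalCone_le g _ _⟩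
  have hsub : convexHull ℝ (Set.range fun g : Γ =>
      z - boundary Γ (n + 1) (normalCone g (n + 1) z) - normalCone g n (boundary Γ n z)) ⊆
      (fun p => z - L p) '' T := by
    refine convexHull_min ?_ ?_
    · rintro _ ⟨g, rfl⟩
      exact ⟨_, subset_convexHull ℝ _ ⟨g, rfl⟩, by simp [L, sub_sub]⟩
    · exact (convex_convexHull ℝ _).affine_image (AffineMap.const ℝ _ z - L.toAffineMap)
  obtain ⟨_, hy, hyε⟩ :=
    Metric.mem_closure_iff.1 (zero_mem_closure_convexHull_defect hΓ n z) ε hε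
  obtain ⟨⟨b, w⟩, hbw, rfl⟩ := hsub hy
  obtain ⟨hb, hw⟩ := hT hbw
  rw [mem_closedBall_zero_iff] at hb hw
  refine ⟨b, hb, ?_⟩
  have hsplit : z - boundary Γ (n + 1) b = w + (z - L (b, w)) := by
    simp only [L, LinearMap.coprod_apply, LinearMap.id_apply]
    abel
  rw [dist_zero_left] at hyε
  rw [hsplit]
  exact (norm_add_le _ _).trans (add_le_add hw hyε.le)

end GroupChain

/-! ### Cycles in the completion bound -/

variable {Γ : Type u} [Group Γ]

lemma exists_norm_sub_ellOneBoundary_le (hΓ : IsAmenableGroup Γ) (n : ℕ) {c : EllOneChain Γ (n + 1)}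
    (hc : ellOneBoundary Γ n c = 0) :
    ∃ b : EllOneChain Γ (n + 2), ‖b‖ ≤ 2 * ‖c‖ ∧
      ‖c - ellOneBoundary Γ (n + 1) b‖ ≤ 2⁻¹ * ‖c‖ := by
  rcases eq_or_ne c 0 with rfl | hc0
  · exact ⟨0, by simp⟩
  have hpos : 0 < ‖c‖ := norm_pos_iff.2 hc0
  -- The total error is at most `δ + (n + 2) δ + δ`.
  set δ : ℝ := ‖c‖ / (2 * (n + 4)) with hδ
  have hδpos : 0 < δ := by positivity
  have hδc : (n + 4 : ℝ) * δ = 2⁻¹ * ‖c‖ := by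
    rw [hδ]
    field_simp
  obtain ⟨_, ⟨z, rfl⟩, hz⟩ := Metric.mem_closure_iff.1
    (UniformSpace.Completion.denseRange_coe (α := GroupChain Γ (n + 1)) c) δ hδpos
  rw [dist_eq_norm] at hz
  have hzc : ‖z‖ ≤ ‖c‖ + δ := by
    have h := norm_sub_le c (c - z)
    rw [sub_sub_cancel, UniformSpace.Completion.norm_coe] at h
    linarith
  have hdz : ‖GroupChain.boundary Γ n z‖ ≤ (n + 2) * δ := by
    have h : ‖ellOneBoundary Γ n (c - z)‖ ≤ (n + 2 : ℝ) * ‖c - z‖ := by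
      refine UniformSpace.Completion.induction_on
        (p := fun c => ‖ellOneBoundary Γ n c‖ ≤ (n + 2 : ℝ) * ‖c‖) (c - z)
        (isClosed_le (by fun_prop) (by fun_prop)) fun y => ?_
      rw [ellOneBoundary_coe, UniformSpace.Completion.norm_coe, UniformSpace.Completion.norm_coe]
      exact GroupChain.norm_boundary_le Γ n y
    rw [map_sub, hc, zero_sub, norm_neg, ellOneBoundary_coe, UniformSpace.Completion.norm_coe] at h
    exact h.trans (by gcongr)
  obtain ⟨b, hb, hzb⟩ := GroupChain.exists_norm_sub_boundary_le hΓ n z hδpos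
  refine ⟨b, ?_, ?_⟩
  · rw [UniformSpace.Completion.norm_coe]
    nlinarith [n.cast_nonneg (α := ℝ)]
  · rw [ellOneBoundary_coe]
    calc ‖c - (GroupChain.boundary Γ (n + 1) b : EllOneChain Γ (n + 1))‖
        ≤ ‖c - z‖ + ‖(z : EllOneChain Γ (n + 1)) - (GroupChain.boundary Γ (n + 1) b :)‖ :=
          norm_sub_le_norm_sub_add_norm_sub _ _ _
      _ ≤ δ + ((n + 2) * δ + δ) := by
          rw [← UniformSpace.Completion.coe_sub, UniformSpace.Completion.norm_coe]
          exact add_le_add hz.le (hzb.trans (by gcongr))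
      _ = 2⁻¹ * ‖c‖ := by
          rw [← hδc]
          ring

lemma exists_ellOneBoundary_eq (hΓ : IsAmenableGroup Γ) (n : ℕ) {c : EllOneChain Γ (n + 1)}
    (hc : ellOneBoundary Γ n c = 0) : ∃ b, ellOneBoundary Γ (n + 1) b = c := by
  have key : ∀ x : {c : EllOneChain Γ (n + 1) // ellOneBoundary Γ n c = 0},
      ∃ b : EllOneChain Γ (n + 2), ‖b‖ ≤ 2 * ‖x.1‖ ∧
        ‖x.1 - ellOneBoundary Γ (n + 1) b‖ ≤ 2⁻¹ * ‖x.1‖ :=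
    fun x => exists_norm_sub_ellOneBoundary_le hΓ n x.2
  choose B hB hB' using key
  let r : ℕ → {c : EllOneChain Γ (n + 1) // ellOneBoundary Γ n c = 0} := fun k =>
    (fun x => ⟨x.1 - ellOneBoundary Γ (n + 1) (B x), by
      rw [map_sub, x.2, ellOneBoundary_comp, sub_zero]⟩)^[k] ⟨c, hc⟩
  have hr_succ : ∀ k, (r (k + 1)).1 = (r k).1 - ellOneBoundary Γ (n + 1) (B (r k)) := fun k => by
    simp only [r, Function.iterate_succ_apply']
  have hr : ∀ k, ‖(r k).1‖ ≤ 2⁻¹ ^ k * ‖c‖ := by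
    intro k
    induction k with
    | zero => simp [r]
    | succ k ih =>
      rw [hr_succ, pow_succ']
      refine (hB' (r k)).trans ?_
      rw [mul_assoc]
      gcongr
  have hgeom : Summable fun k : ℕ => (2⁻¹ : ℝ) ^ k * ‖c‖ :=
    (summable_geometric_of_lt_one (by norm_num) (by norm_num)).mul_right _
  have hsum : Summable fun k => B (r k) :=
    .of_norm_bounded (hgeom.mul_left 2) fun k => (hB _).trans (by gcongr; exact hr k)
  refine ⟨∑' k, B (r k), ?_⟩
  have hpartial : ∀ N, ∑ k ∈ Finset.range N, ellOneBoundary Γ (n + 1) (B (r k)) = c - (r N).1 := by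
    intro N
    induction N with
    | zero => simp [r]
    | succ N ih =>
      rw [Finset.sum_range_succ, ih, hr_succ]
      abel
  have hr0 : Filter.Tendsto (fun N => c - (r N).1) Filter.atTop (nhds (c - 0)) :=
    tendsto_const_nhds.sub (squeeze_zero_norm hr hgeom.tendsto_atTop_zero)
  have hlim := (hsum.hasSum.mapL (ellOneBoundary Γ (n + 1))).tendsto_sum_nat
  simp only [hpartial] at hlim
  simpa using tendsto_nhds_unique hlim hr0

lemma ellOneComplex_d (n : ℕ) :
    (ellOneComplex Γ).d (n + 1) n = ModuleCat.ofHom (ellOneBoundary Γ n).toLinearMap :=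
  ChainComplex.of_d (fun n => ModuleCat.of ℝ (EllOneChain Γ n))
    (fun n => ModuleCat.ofHom (ellOneBoundary Γ n).toLinearMap) n

end EllOneHomology

end

theorem theorem10p1 {Γ : Type*} [Group Γ] (hΓ : IsAmenableGroup Γ) (n : ℕ) (hn : 0 < n) :
    CategoryTheory.Limits.IsZero (EllOneHomology.ellOneHomology Γ n) := by
  obtain ⟨k, rfl⟩ := Nat.exists_eq_succ_of_ne_zero hn.ne'
  refine (HomologicalComplex.exactAt_iff_isZero_homology _ _).1 ?_
  rw [HomologicalComplex.exactAt_iff' _ (k + 2) (k + 1) k (by simp) (by simp),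
    ShortComplex.moduleCat_exact_iff]
  intro c hc
  have hc' : (EllOneHomology.ellOneComplex Γ).d (k + 1) k c = 0 := hc
  rw [EllOneHomology.ellOneComplex_d] at hc'
  obtain ⟨b, hb⟩ := EllOneHomology.exists_ellOneBoundary_eq hΓ k hc'
  refine ⟨b, ?_⟩
  change (EllOneHomology.ellOneComplex Γ).d (k + 2) (k + 1) b = c
  rw [EllOneHomology.ellOneComplex_d]
  exact hb
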